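/- Let $(Y,d_Y)$ be an infinite compact metric space and $g:Y\to Y$ a continuous surjection satisfying Wieler's axioms: there are $\beta>0$, $K\in\mathbb N^+$ and $0<\gamma<1$ such that $d_Y(x,y)\le\beta$ implies $d_Y(g^K(x),g^K(y))\le\gamma^K d_Y(g^{2K}(x),g^{2K}(y))$, and $g^K(B(g^K(x),\epsilon))\subseteq g^{2K}(B(x,\gamma\epsilon))$ for all $x\in Y$ and $0<\epsilon\le\beta$. Let $X=\{(x_n)_{n\ge 0} : g(x_{n+1})=x_n \text{ for all } n\}$ with the product topology, let $\varphi(x_0,x_1,\dots)=(g(x_0),g(x_1),\dots)$, and let $d_X(x,y)=\sum_{i=0}^{K}\gamma^i\, d'_X(\varphi^i(x),\varphi^i(y))$ with $d'_X(x,y)=\sup_n\gamma^n d_Y(x_n,y_n)$. Write $$X^s(x,\epsilon)=\{y : y_m=x_m \text{ for } 0\le m\le K-1,\ d_X(x,y)<\epsilon\},$$ $$X^u(x,\epsilon)=\{y : d_Y(x_n,y_n)<\epsilon \text{ for all } n,\ d_X(x,y)<\epsilon\}.$$ For a finite $\varphi$-invariant set $P$ of periodic points of $\varphi$ let $X^u(P)$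 be the set of $x\in X$ with $\lim_{n\to\infty} d_X(\varphi^{-n}(x),\varphi^{-n}(q))=0$ for some $q\in P$, with the topology in which $U$ is open iff for every $x\in U$ there is $\delta>0$ with $X^u(x,\delta)\cap X^u(P)\subseteq U$. Fix a scale $\epsilon_Y>0$. For $x,y\in X^u(P)$ write $x\sim_0 y$ if $x_0=y_0$ and there are $0<\delta<\epsilon_Y$ and an open $U\subseteq X^u(P)\cap X^u(y,\epsilon_Y)$ with $\pi_0(X^u(x,\delta)\cap X^u(P))=\pi_0(U)$, where $\pi_0(x)=x_0$. Give $X^u(P)/{\sim_0}$ the quotient topology. Then there is $\epsilon_0\in(0,\beta/2]$ such that, for all $\epsilon_X,\epsilon_Y\in(0,\epsilon_0]$ and every finite $\varphi$-invariant set $P$ of periodic points of $\varphi$ for which $X^u(P)$ is dense in $X$, the relation $\sim_0$ is an equivalence relation, the maps $$p:X\to X^u(P)/{\sim_0},\quad p(x)=[y]\ \text{ where } y\in X^u(P)\cap X^s(x,\epsilon_X/2),$$ $$\tilde g:X^u(P)/{\sim_0}\to X^u(P)/{\sim_0},\ \tilde g([x])=[\varphi(x)],\qquad r:X^u(P)/{\sim_0}\to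 Y,\ r([x])=x_0$$ are well defined (such a $y$ exists for each $x$), and: 1. $p$ restricts to a bijection from the periodic points of $\varphi$ onto the periodic points of $\tilde g$. 2. $r$ restricts to a bijection from the periodic points of $\tilde g$ onto the periodic points of $g$. 3. For every $n\ge1$ the maps $\varphi^n$, $\tilde g^n$ and $g^n$ have finitely many fixed points, and $\varphi$, $\tilde g$ and $g$ have the same zeta function, where $\zeta_f(t)=\exp\left(\sum_{n\ge1}\frac{|\mathrm{Fix}(f^n)|}{n}t^n\right)$ as a formal power series. 4. If the periodic points of $\varphi$ are dense in $X$, then the periodic points of $\tilde g$ are dense in $X^u(P)/{\sim_0}$. -/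

import Mathlib

open Set Filter Topology

/-- A compact metric space `Y` with a continuous surjection `g : Y → Y` satisfying Wieler's
two conditions with constants `β`, `K`, `γ`. -/
structure WielerPresolenoid (Y : Type*) [MetricSpace Y] [CompactSpace Y] where
  /-- the self-map of the presolenoid -/
  g : Y → Y
  continuous_g : Continuous g
  surjective_g : Function.Surjective g
  β : ℝ
  K : ℕ
  γ : ℝ
  β_pos : 0 < β
  K_pos : 0 < K
  γ_pos : 0 < γ
  γ_lt_one : γ < 1
  /-- first condition of Wieler -/
  expanding : ∀ x y : Y, dist x y ≤ β →
    dist (g^[K] x) (g^[K] y) ≤ γ ^ K * dist (g^[2 * K] x) (g^[2 * K] y)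
  /-- second condition of Wieler -/
  lifting : ∀ (x : Y) (ε : ℝ), 0 < ε → ε ≤ β →
    g^[K] '' Metric.ball (g^[K] x) ε ⊆ g^[2 * K] '' Metric.ball x (γ * ε)

namespace WielerPresolenoid

variable {Y : Type*} [MetricSpace Y] [CompactSpace Y] (W : WielerPresolenoid Y)

/-- The inverse limit `X` of `(Y, g)`. As a subtype of `ℕ → Y` it carries the topology
induced from the product. -/
abbrev Solenoid : Type _ := {x : ℕ → Y // ∀ i, W.g (x (i + 1)) = x i}

/-- The homeomorphism `φ (x₀, x₁, …) = (g x₀, g x₁, …)` of the solenoid (as a bijection), with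
inverse `(x₀, x₁, …) ↦ (x₁, x₂, …)`. -/
def phi : W.Solenoid ≃ W.Solenoid where
  toFun x := ⟨fun n => W.g (x.1 n), fun i => congrArg W.g (x.2 i)⟩
  invFun x := ⟨fun n => x.1 (n + 1), fun i => x.2 (i + 1)⟩
  left_inv x := Subtype.ext (funext fun n => x.2 n)
  right_inv x := Subtype.ext (funext fun n => x.2 n)

/-- The auxiliary metric `d'(x, y) = sup_n γⁿ d(xₙ, yₙ)`. -/
noncomputable def distAux (x y : W.Solenoid) : ℝ := ⨆ n : ℕ, W.γ ^ n * dist (x.1 n) (y.1 n)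

/-- The metric `d_X(x, y) = ∑_{i=0}^{K} γⁱ d'(φⁱ x, φⁱ y)` of the solenoid. -/
noncomputable def distX (x y : W.Solenoid) : ℝ :=
  ∑ i ∈ Finset.range (W.K + 1), W.γ ^ i * W.distAux (W.phi^[i] x) (W.phi^[i] y)

/-- Unstable equivalence `x ∼ᵤ y`. -/
def UnstableEquiv (x y : W.Solenoid) : Prop :=
  Tendsto (fun n : ℕ => W.distX (W.phi.symm^[n] x) (W.phi.symm^[n] y)) atTop (𝓝 0)

/-- The local stable set `X^s(x, ε)`. -/
def localStable (x : W.Solenoid) (ε : ℝ) : Set W.Solenoid :=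
  {y | (∀ m < W.K, y.1 m = x.1 m) ∧ W.distX x y < ε}

/-- The local unstable set `X^u(x, ε)`. -/
def localUnstable (x : W.Solenoid) (ε : ℝ) : Set W.Solenoid :=
  {y | (∀ n, dist (x.1 n) (y.1 n) < ε) ∧ W.distX x y < ε}

/-- The set `X^u(P)` of points unstably equivalent to a point of `P`. -/
def unstableSet (P : Set W.Solenoid) : Set W.Solenoid :=
  {x | ∃ q ∈ P, W.UnstableEquiv x q}

/-- The space `X^u(P)`. It does not carry the subspace topology of `X`, but the (finer) topology
in which the local unstable sets are the basic neighbourhoods. -/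
def UnstableSpace (P : Set W.Solenoid) : Type _ := {x : W.Solenoid // x ∈ W.unstableSet P}

variable {P : Set W.Solenoid}

/-- The local unstable set of a point of `X^u(P)`, as a subset of `X^u(P)`. -/
def localUnstableIn (x : W.UnstableSpace P) (ε : ℝ) : Set (W.UnstableSpace P) :=
  {y | y.1 ∈ W.localUnstable x.1 ε}

theorem localUnstableIn_mono (x : W.UnstableSpace P) {ε ε' : ℝ} (h : ε ≤ ε') :
    W.localUnstableIn x ε ⊆ W.localUnstableIn x ε' :=
  fun _ hy => ⟨fun n => (hy.1 n).trans_le h, hy.2.trans_le h⟩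

instance : TopologicalSpace (W.UnstableSpace P) where
  IsOpen U := ∀ x ∈ U, ∃ δ : ℝ, 0 < δ ∧ W.localUnstableIn x δ ⊆ U
  isOpen_univ := fun _ _ => ⟨1, one_pos, subset_univ _⟩
  isOpen_inter := by
    rintro U V hU hV x ⟨hxU, hxV⟩
    obtain ⟨δ, hδ, h⟩ := hU x hxU
    obtain ⟨δ', hδ', h'⟩ := hV x hxV
    exact ⟨min δ δ', lt_min hδ hδ', subset_inter
      ((W.localUnstableIn_mono x (min_le_left _ _)).trans h)
      ((W.localUnstableIn_mono x (min_le_right _ _)).trans h')⟩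
  isOpen_sUnion := by
    rintro S hS x ⟨U, hU, hx⟩
    obtain ⟨δ, hδ, h⟩ := hS U hU x hx
    exact ⟨δ, hδ, h.trans (subset_sUnion_of_mem hU)⟩

/-- The projection `π₀ : X^u(P) → Y`, `x ↦ x₀`. -/
def pi0 (x : W.UnstableSpace P) : Y := x.1.1 0

theorem phi_mem_unstableSet (hP : MapsTo W.phi P P) {x : W.Solenoid}
    (hx : x ∈ W.unstableSet P) : W.phi x ∈ W.unstableSet P := by
  obtain ⟨q, hq, h⟩ := hx
  refine ⟨W.phi q, hP hq, (tendsto_add_atTop_iff_nat 1).1 ?_⟩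
  simpa only [UnstableEquiv, Function.iterate_succ_apply, Equiv.symm_apply_apply] using h

/-- The restriction of `φ` to `X^u(P)`, for a `φ`-invariant set `P`. -/
def phiU (hP : MapsTo W.phi P P) (x : W.UnstableSpace P) : W.UnstableSpace P :=
  ⟨W.phi x.1, W.phi_mem_unstableSet hP x.2⟩

/-- The relation `x ∼₀ y` on `X^u(P)`, with scale `εY`. -/
def TildeZero (P : Set W.Solenoid) (εY : ℝ) (x y : W.UnstableSpace P) : Prop :=
  W.pi0 x = W.pi0 y ∧
    ∃ δ : ℝ, 0 < δ ∧ δ < εY ∧ ∃ U : Set (W.UnstableSpace P), IsOpen U ∧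
      U ⊆ W.localUnstableIn y εY ∧ W.pi0 '' W.localUnstableIn x δ = W.pi0 '' U

/-- The quotient `X^u(P)/∼₀`, with the quotient topology. -/
abbrev TildeQuot (P : Set W.Solenoid) (εY : ℝ) : Type _ := Quot (W.TildeZero P εY)

/-- The map `r : X^u(P)/∼₀ → Y`, `[x] ↦ x₀`. -/
def r (P : Set W.Solenoid) (εY : ℝ) : W.TildeQuot P εY → Y :=
  Quot.lift W.pi0 fun _ _ h => h.1

/-- `p : X → X^u(P)/∼₀` is the map `x ↦ [y]` where `y ∈ X^u(P) ∩ X^s(x, εX / 2)`: such `y` exist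
for every `x`, and all of them have the class `p x`. -/
def IsProjection (εX : ℝ) {εY : ℝ} (p : W.Solenoid → W.TildeQuot P εY) : Prop :=
  ∀ x : W.Solenoid,
    (∃ y : W.UnstableSpace P, y.1 ∈ W.localStable x (εX / 2)) ∧
      ∀ y : W.UnstableSpace P, y.1 ∈ W.localStable x (εX / 2) → p x = Quot.mk _ y

/-- `gt` is the map `[x] ↦ [φ x]` on `X^u(P)/∼₀`. -/
def IsInducedMap (hP : MapsTo W.phi P P) {εY : ℝ}
    (gt : W.TildeQuot P εY → W.TildeQuot P εY) : Prop :=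
  ∀ x : W.UnstableSpace P, gt (Quot.mk _ x) = Quot.mk _ (W.phiU hP x)

end WielerPresolenoid

/-- The series `∑_{n ≥ 1} |Fix(fⁿ)| tⁿ / n` (its coefficient at `n = 0` is `0`). -/
noncomputable def fixSeries {α : Type*} (f : α → α) : PowerSeries ℚ :=
  PowerSeries.mk fun n => ((Function.fixedPoints f^[n]).ncard : ℚ) / n

theorem hasSubst_fixSeries {α : Type*} (f : α → α) : PowerSeries.HasSubst (fixSeries f) :=
  PowerSeries.HasSubst.of_constantCoeff_zero' (by simp [fixSeries])

/-- The (Artin-Mazur) zeta function `exp (∑_{n ≥ 1} |Fix(fⁿ)| tⁿ / n)` of a self-map all of whose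
iterates `fⁿ`, `n ≥ 1`, have finitely many fixed points, as a formal power series. -/
noncomputable def zetaFunction {α : Type*} (f : α → α) : PowerSeries ℚ :=
  (PowerSeries.exp ℚ).subst (fixSeries f)

/-!
The dynamical content is that the induced map `gt` on `X^u(P)/∼₀` is shift equivalent to `g`.

Backward orbits that stay `β`-close contract, by Wieler's first condition, and their local unstable
structure is controlled by the zeroth coordinates (`exists_mem_localUnstable`). Therefore `x ∼₀ y`
means that `x₀ = y₀` and that the unstable plaques of `x` and `y`, which are subsets of `Y`, have
the same germ at this point (`tildeZero_iff`); from this description `∼₀` is visibly an equivalence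
relation, and it is preserved by `φ`.

Wieler's second condition lifts a ball around `x_K` of uniform radius along the backward orbit of
`x`, so that its image under `g^K` lies in the plaque of `x` (`exists_lift`). Hence points with the
same zeroth coordinate and nearby `K`-th coordinates are `∼₀`-equivalent
(`IsLiftRadius.tildeZero`). The class of `y` is thus determined by `y_K`. Since `X^u(P)` is dense,
every point of `Y` is such a `K`-th coordinate, which gives a surjection `q : Y → X^u(P)/∼₀`
(`coordClass`). It is continuous (`continuous_coordClass`), and the projection is
`p x = q (x_K)`.

The maps `q` and `r` intertwine `g` and `gt`, with `r ∘ q = g^K` and `q ∘ r = gt^K`. Such a shift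
equivalence is bijective on the fixed points of `n`-th iterates (`bijOn_fixedPoints_of_shiftEquiv`).
As `x ↦ x₀` is bijective from the fixed points of `φ^n` to those of `g^n`, and `r (p x) = x₀`, the
same holds for `p`. The fixed points of `g^n` are uniformly separated by expansiveness, hence finite
in number. Density of the periodic points passes along the continuous surjection `p`.
-/

namespace WielerPresolenoid

variable {Y : Type*} [MetricSpace Y] [CompactSpace Y] (W : WielerPresolenoid Y)

/-! ### Coordinates and the metric of the solenoid -/

theorem phi_iterate_coord (i n : ℕ) (x : W.Solenoid) : (W.phi^[i] x).1 n = W.g^[i] (x.1 n) := by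
  induction i generalizing x with
  | zero => rfl
  | succ i ih => rw [Function.iterate_succ_apply, ih, Function.iterate_succ_apply]; rfl

theorem phi_symm_iterate_coord (i n : ℕ) (x : W.Solenoid) :
    (W.phi.symm^[i] x).1 n = x.1 (n + i) := by
  induction i generalizing x with
  | zero => rfl
  | succ i ih =>
    rw [Function.iterate_succ_apply, ih, ← add_assoc]; rfl

theorem iterate_coord (i n : ℕ) (x : W.Solenoid) : W.g^[i] (x.1 (n + i)) = x.1 n := by
  induction i with
  | zero => rfl
  | succ i ih => rw [Function.iterate_succ_apply, ← add_assoc, x.2, ih]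

theorem iterate_coord_of_le {m n : ℕ} (h : m ≤ n) (x : W.Solenoid) :
    W.g^[n - m] (x.1 n) = x.1 m := by
  have := W.iterate_coord (n - m) m x
  rwa [Nat.add_sub_cancel' h] at this

theorem iterate_coord_zero (n : ℕ) (x : W.Solenoid) : W.g^[n] (x.1 n) = x.1 0 :=
  W.iterate_coord_of_le (Nat.zero_le n) x

theorem bddAbove_distAux (x y : W.Solenoid) :
    BddAbove (range fun n : ℕ => W.γ ^ n * dist (x.1 n) (y.1 n)) := by
  refine ⟨Metric.diam (univ : Set Y), ?_⟩
  rintro _ ⟨n, rfl⟩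
  calc W.γ ^ n * dist (x.1 n) (y.1 n) ≤ 1 * dist (x.1 n) (y.1 n) :=
        mul_le_mul_of_nonneg_right (pow_le_one₀ W.γ_pos.le W.γ_lt_one.le) dist_nonneg
    _ ≤ Metric.diam (univ : Set Y) := by
        rw [one_mul]
        exact Metric.dist_le_diam_of_mem isCompact_univ.isBounded (mem_univ _) (mem_univ _)

theorem le_distAux (x y : W.Solenoid) (n : ℕ) :
    W.γ ^ n * dist (x.1 n) (y.1 n) ≤ W.distAux x y :=
  le_ciSup (W.bddAbove_distAux x y) n

theorem distAux_nonneg (x y : W.Solenoid) : 0 ≤ W.distAux x y :=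
  (mul_nonneg (pow_nonneg W.γ_pos.le 0) dist_nonneg).trans (W.le_distAux x y 0)

theorem distAux_triangle (x y z : W.Solenoid) :
    W.distAux x z ≤ W.distAux x y + W.distAux y z := by
  refine ciSup_le fun n => ?_
  calc W.γ ^ n * dist (x.1 n) (z.1 n)
      ≤ W.γ ^ n * (dist (x.1 n) (y.1 n) + dist (y.1 n) (z.1 n)) :=
        mul_le_mul_of_nonneg_left (dist_triangle _ _ _) (pow_nonneg W.γ_pos.le n)
    _ ≤ W.distAux x y + W.distAux y z := by
        rw [mul_add]; exact add_le_add (W.le_distAux x y n) (W.le_distAux y z n)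

theorem distX_nonneg (x y : W.Solenoid) : 0 ≤ W.distX x y :=
  Finset.sum_nonneg fun i _ => mul_nonneg (pow_nonneg W.γ_pos.le i) (W.distAux_nonneg _ _)

theorem distX_triangle (x y z : W.Solenoid) : W.distX x z ≤ W.distX x y + W.distX y z := by
  rw [distX, distX, distX, ← Finset.sum_add_distrib]
  refine Finset.sum_le_sum fun i _ => ?_
  rw [← mul_add]
  exact mul_le_mul_of_nonneg_left (W.distAux_triangle _ _ _) (pow_nonneg W.γ_pos.le i)

theorem le_distX (x y : W.Solenoid) (n : ℕ) :
    W.γ ^ n * dist (x.1 n) (y.1 n) ≤ W.distX x y := by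
  refine (W.le_distAux x y n).trans ?_
  have := Finset.single_le_sum (f := fun i => W.γ ^ i * W.distAux (W.phi^[i] x) (W.phi^[i] y))
    (fun i _ => mul_nonneg (pow_nonneg W.γ_pos.le i) (W.distAux_nonneg _ _))
    (Finset.mem_range.2 W.K.succ_pos)
  simpa [distX] using this

theorem distX_le {x y : W.Solenoid} {c : ℝ}
    (h : ∀ i ≤ W.K, ∀ n, W.γ ^ n * dist (W.g^[i] (x.1 n)) (W.g^[i] (y.1 n)) ≤ c) :
    W.distX x y ≤ (W.K + 1) * c := by
  have key : ∀ i ∈ Finset.range (W.K + 1),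
      W.γ ^ i * W.distAux (W.phi^[i] x) (W.phi^[i] y) ≤ c := by
    intro i hi
    refine (mul_le_of_le_one_left (W.distAux_nonneg _ _)
      (pow_le_one₀ W.γ_pos.le W.γ_lt_one.le)).trans (ciSup_le fun n => ?_)
    rw [phi_iterate_coord, phi_iterate_coord]
    exact h i (Nat.lt_succ_iff.1 (Finset.mem_range.1 hi)) n
  simpa [distX] using Finset.sum_le_sum key

theorem exists_dist_iterate_lt (M : ℕ) {ε : ℝ} (hε : 0 < ε) :
    ∃ η > 0, ∀ a b : Y, dist a b < η → ∀ i ≤ M, dist (W.g^[i] a) (W.g^[i] b) < ε := by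
  induction M with
  | zero => exact ⟨ε, hε, fun a b h i hi => by obtain rfl := Nat.le_zero.1 hi; exact h⟩
  | succ M ih =>
    obtain ⟨η, hη, h⟩ := ih
    obtain ⟨η', hη', h'⟩ := Metric.uniformContinuous_iff.1
      (CompactSpace.uniformContinuous_of_continuous (W.continuous_g.iterate (M + 1))) ε hε
    refine ⟨min η η', lt_min hη hη', fun a b hab i hi => ?_⟩
    rcases Nat.le_succ_iff.1 hi with hi | rfl
    · exact h a b (hab.trans_le (min_le_left _ _)) i hi
    · exact h' (hab.trans_le (min_le_right _ _))

/-! ### Contraction along backward orbits -/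

variable {W}

/-- Wieler's first condition, read along two backward orbits that stay `β`-close. -/
theorem dist_coord_add_mul_le {x y : W.Solenoid} (h : ∀ n, dist (x.1 n) (y.1 n) ≤ W.β)
    (j n : ℕ) :
    dist (x.1 (n + j * W.K)) (y.1 (n + j * W.K)) ≤ (W.γ ^ W.K) ^ j * dist (x.1 n) (y.1 n) := by
  have step : ∀ n, dist (x.1 (n + W.K)) (y.1 (n + W.K)) ≤ W.γ ^ W.K * dist (x.1 n) (y.1 n) := by
    intro n
    have := W.expanding _ _ (h (n + 2 * W.K))
    rwa [iterate_coord, iterate_coord, two_mul, ← add_assoc, iterate_coord, iterate_coord] at this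
  induction j with
  | zero => simp
  | succ j ih =>
    rw [Nat.succ_mul, ← add_assoc, pow_succ', mul_assoc]
    exact (step _).trans (mul_le_mul_of_nonneg_left ih (pow_nonneg W.γ_pos.le _))

theorem dist_coord_add_mul_le' {x y : W.Solenoid} (h : ∀ n, dist (x.1 n) (y.1 n) ≤ W.β)
    (j n : ℕ) : dist (x.1 (n + j * W.K)) (y.1 (n + j * W.K)) ≤ dist (x.1 n) (y.1 n) :=
  (dist_coord_add_mul_le h j n).trans (mul_le_of_le_one_left dist_nonneg
    (pow_le_one₀ (pow_nonneg W.γ_pos.le _) (pow_le_one₀ W.γ_pos.le W.γ_lt_one.le)))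

/-- Expansiveness: `x ↦ x₀` is injective on local unstable sets. -/
theorem eq_of_coord_zero_eq {x y : W.Solenoid} (h : ∀ n, dist (x.1 n) (y.1 n) ≤ W.β)
    (h0 : x.1 0 = y.1 0) : x = y := by
  refine Subtype.ext (funext fun n => ?_)
  have hn : n ≤ 0 + n * W.K := by simpa using Nat.le_mul_of_pos_right n W.K_pos
  rw [← W.iterate_coord_of_le hn x, ← W.iterate_coord_of_le hn y]
  congr 1
  have := dist_coord_add_mul_le' h n 0
  rw [h0, dist_self] at this
  exact dist_le_zero.1 this

variable (W) in
/-- On orbits that stay `β`-close, the distance of the zeroth coordinates controls all of the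
local unstable structure, uniformly. -/
theorem exists_mem_localUnstable {ε : ℝ} (hε : 0 < ε) :
    ∃ η > 0, ∀ x y : W.Solenoid, (∀ n, dist (x.1 n) (y.1 n) ≤ W.β) →
      dist (x.1 0) (y.1 0) < η → y ∈ W.localUnstable x ε := by
  have hK : (0 : ℝ) < W.K + 2 := by positivity
  -- `distX` has `K + 1` terms, and `K + 2` leaves room for a strict inequality
  obtain ⟨η, hη, H⟩ := W.exists_dist_iterate_lt (2 * W.K) (div_pos hε hK)
  refine ⟨η, hη, fun x y h h0 => ?_⟩
  have key : ∀ i ≤ W.K, ∀ n, dist (W.g^[i] (x.1 n)) (W.g^[i] (y.1 n)) < ε / (W.K + 2) := by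
    intro i hi n
    -- `N` is the first multiple of `K` beyond `n`
    set N := 0 + (n / W.K + 1) * W.K with hN
    have h1 : n ≤ N := by
      rw [hN, zero_add, Nat.succ_mul]; exact (Nat.lt_div_mul_add W.K_pos).le
    have h2 : N ≤ n + W.K := by
      rw [hN, zero_add, Nat.succ_mul]; exact Nat.add_le_add_right (Nat.div_mul_le_self _ _) _
    rw [← W.iterate_coord_of_le h1 x, ← W.iterate_coord_of_le h1 y,
      ← Function.iterate_add_apply, ← Function.iterate_add_apply]
    exact H _ _ ((dist_coord_add_mul_le' h _ 0).trans_lt h0) _ (by omega)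
  have hle : ε / (W.K + 2) ≤ ε := div_le_self hε.le (by linarith [(W.K.cast_nonneg : (0 : ℝ) ≤ _)])
  refine ⟨fun n => (key 0 (Nat.zero_le _) n).trans_le hle, ?_⟩
  refine (W.distX_le fun i hi n => (mul_le_of_le_one_left dist_nonneg
    (pow_le_one₀ W.γ_pos.le W.γ_lt_one.le)).trans (key i hi n).le).trans_lt ?_
  rw [mul_div_assoc', div_lt_iff₀ hK]
  nlinarith

theorem tendsto_dist_coord {x y : W.Solenoid} (h : ∀ n, dist (x.1 n) (y.1 n) ≤ W.β) :
    Tendsto (fun n => dist (x.1 n) (y.1 n)) atTop (𝓝 0) := by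
  rw [Metric.tendsto_atTop]
  intro ε hε
  obtain ⟨η, hη, H⟩ := W.exists_mem_localUnstable hε
  obtain ⟨J, hJ⟩ := exists_pow_lt_of_lt_one (div_pos hη W.β_pos)
    (pow_lt_one₀ W.γ_pos.le W.γ_lt_one W.K_pos.ne')
  refine ⟨J * W.K, fun n hn => ?_⟩
  rw [Real.dist_0_eq_abs, abs_of_nonneg dist_nonneg]
  have := (H (W.phi.symm^[J * W.K] x) (W.phi.symm^[J * W.K] y)
    (fun m => by simpa only [phi_symm_iterate_coord] using h _) ?_).1 (n - J * W.K)
  · simpa only [phi_symm_iterate_coord, Nat.sub_add_cancel hn] using this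
  · rw [phi_symm_iterate_coord, phi_symm_iterate_coord]
    calc _ ≤ (W.γ ^ W.K) ^ J * dist (x.1 0) (y.1 0) := dist_coord_add_mul_le h J 0
      _ ≤ (W.γ ^ W.K) ^ J * W.β :=
          mul_le_mul_of_nonneg_left (h 0) (pow_nonneg (pow_nonneg W.γ_pos.le _) _)
      _ < η := (lt_div_iff₀ W.β_pos).1 hJ

theorem unstableEquiv_of_tendsto {x y : W.Solenoid}
    (h : Tendsto (fun n => dist (x.1 n) (y.1 n)) atTop (𝓝 0)) : W.UnstableEquiv x y := by
  rw [UnstableEquiv, Metric.tendsto_atTop]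
  intro ε hε
  obtain ⟨η, hη, H⟩ := W.exists_mem_localUnstable hε
  obtain ⟨N, hN⟩ := eventually_atTop.1 (h.eventually (gt_mem_nhds (lt_min hη W.β_pos)))
  refine ⟨N, fun n hn => ?_⟩
  rw [Real.dist_0_eq_abs, abs_of_nonneg (W.distX_nonneg _ _)]
  refine (H _ _ (fun m => ?_) ?_).2 <;> rw [phi_symm_iterate_coord, phi_symm_iterate_coord]
  · exact ((hN _ (by omega)).trans_le (min_le_right _ _)).le
  · exact (hN _ (by omega)).trans_le (min_le_left _ _)

theorem UnstableEquiv.trans {x y z : W.Solenoid} (h : W.UnstableEquiv x y)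
    (h' : W.UnstableEquiv y z) : W.UnstableEquiv x z :=
  squeeze_zero (fun _ => W.distX_nonneg _ _) (fun _ => W.distX_triangle _ _ _)
    (by simpa using Tendsto.add h h')

theorem mem_unstableSet_of_dist_tendsto {P : Set W.Solenoid} {x y : W.Solenoid}
    (hx : x ∈ W.unstableSet P) (h : Tendsto (fun n => dist (x.1 n) (y.1 n)) atTop (𝓝 0)) :
    y ∈ W.unstableSet P := by
  obtain ⟨q, hq, hxq⟩ := hx
  exact ⟨q, hq, (unstableEquiv_of_tendsto (by simpa only [dist_comm] using h)).trans hxq⟩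

theorem mem_localUnstable_self (x : W.Solenoid) {ε : ℝ} (hε : 0 < ε) :
    x ∈ W.localUnstable x ε := by
  refine ⟨fun n => by rwa [dist_self], ?_⟩
  refine (W.distX_le (c := 0) fun i _ n => by simp).trans_lt (by simpa)

/-- Local unstable sets are open in the topology they generate. The suprema in their definition
are attained because the coordinates contract. -/
theorem exists_localUnstable_subset {x y : W.Solenoid} {δ : ℝ} (hδ : δ ≤ W.β)
    (hy : y ∈ W.localUnstable x δ) :
    ∃ η > 0, W.localUnstable y η ⊆ W.localUnstable x δ := by
  have hb : ∀ n, dist (x.1 n) (y.1 n) ≤ W.β := fun n => (hy.1 n).le.trans hδ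
  obtain ⟨m, -, hm⟩ := Finset.exists_max_image (Finset.range W.K)
    (fun n => dist (x.1 n) (y.1 n)) ⟨0, Finset.mem_range.2 W.K_pos⟩
  have hmax : ∀ n, dist (x.1 n) (y.1 n) ≤ dist (x.1 m) (y.1 m) := fun n => by
    have := dist_coord_add_mul_le' hb (n / W.K) (n % W.K)
    rw [Nat.mod_add_div'] at this
    exact this.trans (hm _ (Finset.mem_range.2 (Nat.mod_lt _ W.K_pos)))
  refine ⟨min (δ - dist (x.1 m) (y.1 m)) (δ - W.distX x y),
    lt_min (sub_pos.2 (hy.1 m)) (sub_pos.2 hy.2), fun z hz => ⟨fun n => ?_, ?_⟩⟩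
  · have := (hz.1 n).trans_le (min_le_left _ _)
    linarith [dist_triangle (x.1 n) (y.1 n) (z.1 n), hmax n]
  · have := hz.2.trans_le (min_le_right _ _)
    linarith [W.distX_triangle x y z]

variable (W) in
/-- Wieler's second condition lifts a point near `x_K` along the whole backward orbit `x`. As the
condition only lifts images under `g^K`, the lifted orbit starts at `g^K z`. -/
theorem exists_lift {ε : ℝ} (hε : 0 < ε) :
    ∃ ρ > 0, ∀ (x : W.Solenoid) (z : Y), dist z (x.1 W.K) < ρ →
      ∃ w : W.Solenoid, w.1 0 = W.g^[W.K] z ∧ ∀ n, dist (x.1 n) (w.1 n) < ε := by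
  obtain ⟨η, hη, H⟩ := W.exists_dist_iterate_lt (2 * W.K) hε
  refine ⟨min η W.β, lt_min hη W.β_pos, fun x z hz => ?_⟩
  set ρ := min η W.β
  have hρ : 0 < ρ := lt_min hη W.β_pos
  have step : ∀ (j : ℕ) (a : {a : Y // dist a (x.1 (j * W.K + W.K)) < ρ}),
      ∃ b : {b : Y // dist b (x.1 ((j + 1) * W.K + W.K)) < ρ},
        W.g^[2 * W.K] b.1 = W.g^[W.K] a.1 := by
    rintro j ⟨a, ha⟩
    have := @W.lifting (x.1 ((j + 1) * W.K + W.K)) ρ hρ (min_le_right _ _) (W.g^[W.K] a)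
      ⟨a, by rwa [iterate_coord, Nat.succ_mul], rfl⟩
    obtain ⟨b, hb, hba⟩ := this
    exact ⟨⟨b, (Metric.mem_ball.1 hb).trans_le (mul_le_of_le_one_left hρ.le W.γ_lt_one.le)⟩, hba⟩
  choose F hF using step
  let s : ∀ j : ℕ, {a : Y // dist a (x.1 (j * W.K + W.K)) < ρ} :=
    fun j => Nat.rec ⟨z, by simpa using hz⟩ F j
  have hs : ∀ j, W.g^[2 * W.K] (s (j + 1)).1 = W.g^[W.K] (s j).1 := fun j => hF j (s j)
  -- the candidate for the `n`-th coordinate does not depend on `j` as soon as `n ≤ j * K`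
  have hind : ∀ n j i, n ≤ j * W.K →
      W.g^[(j + i) * W.K + W.K - n] (s (j + i)).1 = W.g^[j * W.K + W.K - n] (s j).1 := by
    intro n j i hn
    induction i with
    | zero => rfl
    | succ i ih =>
      have hle : j * W.K ≤ (j + i) * W.K := Nat.mul_le_mul_right _ (Nat.le_add_right _ _)
      have e1 : (j + (i + 1)) * W.K + W.K - n = ((j + i) * W.K - n) + 2 * W.K := by
        rw [← add_assoc, Nat.succ_mul]; omega
      have e2 : (j + i) * W.K + W.K - n = ((j + i) * W.K - n) + W.K := by omega
      rw [← ih, e1, Function.iterate_add_apply, ← add_assoc, hs, ← Function.iterate_add_apply, e2]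
  have hle : ∀ n, n ≤ n * W.K := fun n => Nat.le_mul_of_pos_right n W.K_pos
  refine ⟨⟨fun n => W.g^[n * W.K + W.K - n] (s n).1, fun n => ?_⟩, ?_, fun n => ?_⟩
  · change _ = W.g^[n * W.K + W.K - n] (s n).1
    rw [← Function.iterate_succ_apply' W.g, ← hind n n 1 (hle n)]
    congr 2
    have := hle (n + 1)
    omega
  · simp [s]
  · set j := n / W.K + 1 with hj
    have h1 : n ≤ j * W.K := by
      rw [hj, Nat.succ_mul]; exact (Nat.lt_div_mul_add W.K_pos).le
    have h2 : j * W.K ≤ n + W.K := by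
      rw [hj, Nat.succ_mul]; exact Nat.add_le_add_right (Nat.div_mul_le_self _ _) _
    have e : W.g^[n * W.K + W.K - n] (s n).1 = W.g^[j * W.K + W.K - n] (s j).1 := by
      rw [← hind n n j (hle n), add_comm n j, hind n j n h1]
    simp only [e]
    rw [← W.iterate_coord_of_le (h1.trans (Nat.le_add_right _ W.K)) x, dist_comm]
    exact H _ _ ((s j).2.trans_le (min_le_left _ _)) _ (by omega)

/-! ### Germs of unstable plaques and the relation `∼₀` -/

variable (W) in
/-- The unstable plaque of `x`: the image under `x ↦ x₀` of the points of the solenoid whose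
backward orbit stays `β`-close to that of `x`. -/
def plaque (x : W.Solenoid) : Set Y := {a | ∃ w : W.Solenoid, w.1 0 = a ∧
  ∀ n, dist (x.1 n) (w.1 n) < W.β}

variable {P : Set W.Solenoid}

theorem exists_of_mem_plaque {x : W.UnstableSpace P} {a : Y} (ha : a ∈ W.plaque x.1) :
    ∃ w : W.UnstableSpace P, W.pi0 w = a ∧ ∀ n, dist (x.1.1 n) (w.1.1 n) < W.β := by
  obtain ⟨w, hw, h⟩ := ha
  exact ⟨⟨w, mem_unstableSet_of_dist_tendsto x.2 (tendsto_dist_coord fun n => (h n).le)⟩, hw, h⟩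

theorem isOpen_localUnstableIn (x : W.UnstableSpace P) {δ : ℝ} (hδ : δ ≤ W.β) :
    IsOpen (W.localUnstableIn x δ) := fun _ hy => by
  obtain ⟨η, hη, h⟩ := exists_localUnstable_subset hδ hy
  exact ⟨η, hη, fun z hz => h hz⟩

/-- Near `x₀` the plaque of `x` is the image of arbitrarily small local unstable sets. -/
theorem exists_plaque_subset (W : WielerPresolenoid Y) {ε : ℝ} (hε : 0 < ε) :
    ∃ η > 0, ∀ {P : Set W.Solenoid} (x : W.UnstableSpace P) (a : Y), a ∈ W.plaque x.1 →
      dist a (W.pi0 x) < η → ∃ w ∈ W.localUnstableIn x ε, W.pi0 w = a := by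
  obtain ⟨η, hη, H⟩ := W.exists_mem_localUnstable hε
  refine ⟨η, hη, fun {P} x a ha hd => ?_⟩
  obtain ⟨w, rfl, hw⟩ := exists_of_mem_plaque ha
  exact ⟨w, H _ _ (fun n => (hw n).le) (by rwa [dist_comm]), rfl⟩

theorem pi0_mem_plaque {x w : W.UnstableSpace P} {δ : ℝ} (hδ : δ ≤ W.β)
    (hw : w ∈ W.localUnstableIn x δ) : W.pi0 w ∈ W.plaque x.1 :=
  ⟨w.1, rfl, fun n => (hw.1 n).trans_le hδ⟩

/-- The witness is the set `U` of points near `y` whose zeroth coordinate lies in the image of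
`X^u(x, δ)`. It is open because the zeroth coordinate determines the points of a local unstable set
continuously. -/
theorem TildeZero.of_plaque_eventuallyEq {εY : ℝ} (hεY : 0 < εY) (hεβ : εY ≤ W.β / 2)
    {x y : W.UnstableSpace P} (h0 : W.pi0 x = W.pi0 y)
    (h : W.plaque x.1 =ᶠ[𝓝 (W.pi0 x)] W.plaque y.1) : W.TildeZero P εY x y := by
  have hβ := W.β_pos
  obtain ⟨η, hη, H⟩ := Metric.eventually_nhds_iff.1 h.mem_iff
  obtain ⟨η₁, hη₁, H₁⟩ := W.exists_plaque_subset hεY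
  obtain ⟨η₂, hη₂, H₂⟩ := W.exists_plaque_subset (half_pos hβ)
  -- within `μ` of `x₀` the plaques agree, and their points lift to small local unstable sets
  set μ := min (min η η₁) (min η₂ (W.β / 2))
  have hμ : 0 < μ := lt_min (lt_min hη hη₁) (lt_min hη₂ (half_pos hβ))
  have hμη : μ ≤ η := (min_le_left _ _).trans (min_le_left _ _)
  have hμη₁ : μ ≤ η₁ := (min_le_left _ _).trans (min_le_right _ _)
  have hμη₂ : μ ≤ η₂ := (min_le_right _ _).trans (min_le_left _ _)
  have hμβ : μ ≤ W.β / 2 := (min_le_right _ _).trans (min_le_right _ _)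
  set δ := min (εY / 2) (μ / 2)
  have hδ : 0 < δ := lt_min (half_pos hεY) (half_pos hμ)
  have hδμ : δ ≤ μ / 2 := min_le_right _ _
  refine ⟨h0, δ, hδ, (min_le_left _ _).trans_lt (half_lt_self hεY),
    {w | w ∈ W.localUnstableIn y εY ∧ W.pi0 w ∈ W.pi0 '' W.localUnstableIn x δ},
    ?_, fun w hw => hw.1, ?_⟩
  · rintro w ⟨hwy, v, hvx, hvw⟩
    obtain ⟨δ₁, hδ₁, h₁⟩ := isOpen_localUnstableIn y (hεβ.trans (by linarith)) w hwy
    obtain ⟨δ₂, hδ₂, h₂⟩ := isOpen_localUnstableIn x (by linarith : δ ≤ W.β) v hvx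
    obtain ⟨η₃, hη₃, H₃⟩ := W.exists_mem_localUnstable hδ₂
    refine ⟨min δ₁ (min η₃ (μ / 2)), lt_min hδ₁ (lt_min hη₃ (half_pos hμ)), fun w' hw' => ?_⟩
    have hw'y := h₁ (W.localUnstableIn_mono w (min_le_left _ _) hw')
    refine ⟨hw'y, ?_⟩
    have d1 : dist (W.pi0 v) (W.pi0 w') < min η₃ (μ / 2) := by
      rw [hvw]; exact (hw'.1 0).trans_le (min_le_right _ _)
    have d2 : dist (W.pi0 w') (W.pi0 x) < μ := by
      have e1 : dist (W.pi0 x) (W.pi0 v) < δ := hvx.1 0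
      have e2 := d1.trans_le (min_le_right _ _)
      rw [dist_comm]
      linarith [dist_triangle (W.pi0 x) (W.pi0 v) (W.pi0 w')]
    -- `w'₀` lies on the plaque of `y`, hence on that of `x`; its lift `v'` near `x` is close to `v`
    have hmem : W.pi0 w' ∈ W.plaque x.1 := by
      rw [H (d2.trans_le hμη)]
      exact pi0_mem_plaque (hεβ.trans (by linarith)) hw'y
    obtain ⟨v', hv', hv'w'⟩ := H₂ x _ hmem (d2.trans_le hμη₂)
    refine ⟨v', h₂ (H₃ v.1 v'.1 (fun n => ?_) ?_), hv'w'⟩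
    · have e1 := hv'.1 n
      have e2 := hvx.1 n
      rw [dist_comm] at e2
      linarith [dist_triangle (v.1.1 n) (x.1.1 n) (v'.1.1 n)]
    · change dist (W.pi0 v) (W.pi0 v') < η₃
      rw [hv'w']
      exact d1.trans_le (min_le_left _ _)
  · apply Subset.antisymm
    · rintro _ ⟨v, hv, rfl⟩
      have d : dist (W.pi0 v) (W.pi0 x) < μ := by
        rw [dist_comm]
        exact (hv.1 0).trans_le (by linarith)
      have hmem : W.pi0 v ∈ W.plaque y.1 := by
        rw [← H (d.trans_le hμη)]
        exact pi0_mem_plaque (by linarith) hv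
      obtain ⟨w, hw, hwv⟩ := H₁ y _ hmem (by rw [← h0]; exact d.trans_le hμη₁)
      exact ⟨w, ⟨hw, v, hv, hwv.symm⟩, hwv⟩
    · rintro _ ⟨w, hw, rfl⟩
      exact hw.2

theorem TildeZero.plaque_eventuallyEq {εY : ℝ} (hεβ : εY ≤ W.β / 2)
    {x y : W.UnstableSpace P} (h : W.TildeZero P εY x y) :
    W.plaque x.1 =ᶠ[𝓝 (W.pi0 x)] W.plaque y.1 := by
  have hβ := W.β_pos
  obtain ⟨h0, δ, hδ, hδε, U, hU, hUy, hπ⟩ := h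
  -- `x₀ = y₀` has a preimage in `U`, which is `y` by expansiveness
  have hyU : y ∈ U := by
    obtain ⟨u, hu, hux⟩ : W.pi0 x ∈ W.pi0 '' U :=
      hπ ▸ mem_image_of_mem _ (mem_localUnstable_self x.1 hδ)
    have : y = u := Subtype.ext (eq_of_coord_zero_eq
      (fun n => ((hUy hu).1 n).le.trans (by linarith)) (h0.symm.trans hux.symm))
    rwa [this]
  obtain ⟨δ', hδ', hsub⟩ := hU y hyU
  obtain ⟨η₁, hη₁, H₁⟩ := W.exists_plaque_subset hδ
  obtain ⟨η₂, hη₂, H₂⟩ := W.exists_plaque_subset hδ'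
  refine Filter.eventuallyEq_set.2 ?_
  filter_upwards [Metric.ball_mem_nhds (W.pi0 x) hη₁, Metric.ball_mem_nhds (W.pi0 x) hη₂]
    with a ha₁ ha₂
  constructor
  · intro ha
    obtain ⟨w, hw, rfl⟩ := H₁ x a ha ha₁
    obtain ⟨u, hu, huw⟩ : W.pi0 w ∈ W.pi0 '' U := hπ ▸ mem_image_of_mem _ hw
    rw [← huw]
    exact pi0_mem_plaque (by linarith) (hUy hu)
  · intro ha
    obtain ⟨w, hw, rfl⟩ := H₂ y a ha (by rw [← h0]; exact ha₂)
    obtain ⟨v, hv, hvw⟩ : W.pi0 w ∈ W.pi0 '' W.localUnstableIn x δ :=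
      hπ ▸ mem_image_of_mem _ (hsub hw)
    rw [← hvw]
    exact pi0_mem_plaque (by linarith) hv

/-- Points are `∼₀`-equivalent when they have the same zeroth coordinate and the same germ of
unstable plaques there. In particular `∼₀` does not depend on the scale. -/
theorem tildeZero_iff {εY : ℝ} (hεY : 0 < εY) (hεβ : εY ≤ W.β / 2) {x y : W.UnstableSpace P} :
    W.TildeZero P εY x y ↔
      W.pi0 x = W.pi0 y ∧ W.plaque x.1 =ᶠ[𝓝 (W.pi0 x)] W.plaque y.1 :=
  ⟨fun h => ⟨h.1, h.plaque_eventuallyEq hεβ⟩, fun h => .of_plaque_eventuallyEq hεY hεβ h.1 h.2⟩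

theorem equivalence_tildeZero {εY : ℝ} (hεY : 0 < εY) (hεβ : εY ≤ W.β / 2) :
    Equivalence (W.TildeZero P εY) where
  refl x := (tildeZero_iff hεY hεβ).2 ⟨rfl, .rfl⟩
  symm {x y} h := by
    rw [tildeZero_iff hεY hεβ] at h ⊢
    exact ⟨h.1.symm, h.1 ▸ h.2.symm⟩
  trans {x y z} h h' := by
    rw [tildeZero_iff hεY hεβ] at h h' ⊢
    exact ⟨h.1.trans h'.1, h.2.trans (h.1 ▸ h'.2)⟩

/-- The germ of the plaque of `φ x` is determined by that of the plaque of `x`: a point shadowing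
`φ x` closely has a first coordinate on the plaque of `x`. -/
theorem plaque_phi_eventually {x y : W.UnstableSpace P} (h0 : W.pi0 x = W.pi0 y)
    (h : W.plaque x.1 =ᶠ[𝓝 (W.pi0 x)] W.plaque y.1) :
    ∀ᶠ a in 𝓝 (W.g (W.pi0 x)), a ∈ W.plaque (W.phi x.1) → a ∈ W.plaque (W.phi y.1) := by
  obtain ⟨η, hη, H⟩ := Metric.eventually_nhds_iff.1 h.mem_iff
  obtain ⟨θ, hθ, Hθ⟩ := W.exists_dist_iterate_lt 1 W.β_pos
  obtain ⟨η₁, hη₁, H₁⟩ := W.exists_plaque_subset hθ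
  obtain ⟨η₂, hη₂, H₂⟩ := W.exists_mem_localUnstable
    (lt_min (lt_min hη hη₁) W.β_pos)
  filter_upwards [Metric.ball_mem_nhds _ hη₂] with a ha hax
  obtain ⟨w, rfl, hw⟩ := hax
  have hw' := (H₂ (W.phi x.1) w (fun n => (hw n).le) (by rwa [dist_comm])).1
  -- `w₁` lies on the plaque of `x`, since `w` shadows `φ x`
  have hc : ∀ n, dist (x.1.1 n) (w.1 (n + 1)) < min (min η η₁) W.β := fun n => by
    have := hw' (n + 1)
    rwa [show (W.phi x.1).1 (n + 1) = x.1.1 n from x.1.2 n] at this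
  have d : dist (w.1 1) (W.pi0 x) < min (min η η₁) W.β := by rw [dist_comm]; exact hc 0
  have hmem : w.1 1 ∈ W.plaque y.1 := by
    rw [← H (d.trans_le ((min_le_left _ _).trans (min_le_left _ _)))]
    exact ⟨W.phi.symm w, rfl, fun n => (hc n).trans_le (min_le_right _ _)⟩
  obtain ⟨v, hv, hvw⟩ := H₁ y _ hmem
    (by rw [← h0]; exact d.trans_le ((min_le_left _ _).trans (min_le_right _ _)))
  refine ⟨W.phi v.1, ?_, fun n => Hθ _ _ (hv.1 n) 1 le_rfl⟩
  change W.g (W.pi0 v) = w.1 0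
  rw [hvw]
  exact w.2 0

theorem TildeZero.phiU {εY : ℝ} (hεY : 0 < εY) (hεβ : εY ≤ W.β / 2) (hP : MapsTo W.phi P P)
    {x y : W.UnstableSpace P} (h : W.TildeZero P εY x y) :
    W.TildeZero P εY (W.phiU hP x) (W.phiU hP y) := by
  rw [tildeZero_iff hεY hεβ] at h ⊢
  obtain ⟨h0, h⟩ := h
  refine ⟨congrArg W.g h0, Filter.eventuallyEq_set.2 ?_⟩
  have h1 := plaque_phi_eventually h0 h
  have h2 := plaque_phi_eventually h0.symm (h0 ▸ h.symm)
  rw [← h0] at h2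
  filter_upwards [h1, h2] with a ha hb using ⟨ha, hb⟩

/-! ### The class of a point depends on its `K`-th coordinate -/

variable (W) in
/-- The property of a radius `ρ` that balls of radius `ρ` lift to plaques. -/
def IsLiftRadius (ρ : ℝ) : Prop :=
  ∀ (x : W.Solenoid) (z : Y), dist z (x.1 W.K) < ρ → W.g^[W.K] z ∈ W.plaque x

variable (W) in
theorem exists_isLiftRadius : ∃ ρ > 0, W.IsLiftRadius ρ := by
  obtain ⟨ρ, hρ, h⟩ := W.exists_lift W.β_pos
  exact ⟨ρ, hρ, h⟩

theorem IsLiftRadius.plaque_eventually {ρ : ℝ} (hρ : W.IsLiftRadius ρ) {x y : W.UnstableSpace P}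
    (hK : dist (x.1.1 W.K) (y.1.1 W.K) < ρ) :
    ∀ᶠ a in 𝓝 (W.pi0 y), a ∈ W.plaque y.1 → a ∈ W.plaque x.1 := by
  obtain ⟨η, hη, H⟩ := W.exists_plaque_subset (sub_pos.2 hK)
  filter_upwards [Metric.ball_mem_nhds _ hη] with a ha hay
  obtain ⟨w, hw, rfl⟩ := H y a hay ha
  have hwK : W.pi0 w = W.g^[W.K] (w.1.1 W.K) := (W.iterate_coord_zero W.K w.1).symm
  rw [hwK]
  refine hρ x.1 _ ?_
  rw [dist_comm]
  linarith [hw.1 W.K, dist_triangle (x.1.1 W.K) (y.1.1 W.K) (w.1.1 W.K)]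

theorem IsLiftRadius.tildeZero {ρ : ℝ} (hρ : W.IsLiftRadius ρ) {εY : ℝ} (hεY : 0 < εY)
    (hεβ : εY ≤ W.β / 2) {x y : W.UnstableSpace P} (h0 : W.pi0 x = W.pi0 y)
    (hK : dist (x.1.1 W.K) (y.1.1 W.K) < ρ) : W.TildeZero P εY x y := by
  refine (tildeZero_iff hεY hεβ).2 ⟨h0, Filter.eventuallyEq_set.2 ?_⟩
  have h1 := hρ.plaque_eventually (by rwa [dist_comm] : dist (y.1.1 W.K) (x.1.1 W.K) < ρ)
  have h2 := hρ.plaque_eventually hK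
  rw [← h0] at h2
  filter_upwards [h1, h2] with a ha hb using ⟨ha, hb⟩

/-- The lifting condition and the density of `X^u(P)` provide a point of `X^u(P)` with a prescribed
`N`-th coordinate, hence with the first `N + 1` coordinates of any given point. -/
theorem exists_coord_eq (hd : Dense (W.unstableSet P)) (x : W.Solenoid) (N : ℕ) :
    ∃ y : W.UnstableSpace P, y.1.1 N = x.1 N := by
  obtain ⟨ρ, hρ, H⟩ := W.exists_lift W.β_pos
  have hcont : Continuous fun y : W.Solenoid => y.1 (N + W.K) :=
    (continuous_apply _).comp continuous_subtype_val
  obtain ⟨y, hyb, hy⟩ := hd.inter_open_nonempty _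
    (Metric.isOpen_ball.preimage hcont) ⟨x, Metric.mem_ball_self (x := x.1 (N + W.K)) hρ⟩
  obtain ⟨w, hw0, hw⟩ := H (W.phi.symm^[N] y) (x.1 (N + W.K)) (by
    rw [phi_symm_iterate_coord, dist_comm, add_comm W.K N]; exact hyb)
  have hshift : ∀ n, (W.phi^[N] w).1 (n + N) = w.1 n := fun n => by
    rw [phi_iterate_coord, iterate_coord]
  refine ⟨⟨W.phi^[N] w, mem_unstableSet_of_dist_tendsto hy
    ((tendsto_add_atTop_iff_nat N).1 ?_)⟩, ?_⟩
  · have := tendsto_dist_coord fun n => (hw n).le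
    simpa only [phi_symm_iterate_coord, hshift] using this
  · change (W.phi^[N] w).1 N = x.1 N
    have := hshift 0
    rw [zero_add] at this
    rw [this, hw0, iterate_coord]

theorem surjective_coord (N : ℕ) : Function.Surjective fun x : W.Solenoid => x.1 N := by
  intro a
  choose s hs using W.surjective_g
  refine ⟨W.phi^[N] ⟨fun n => s^[n] a, fun n => ?_⟩, ?_⟩
  · change W.g (s^[n + 1] a) = s^[n] a
    rw [Function.iterate_succ_apply', hs]
  · change (W.phi^[N] _).1 N = a
    rw [phi_iterate_coord]
    exact Function.LeftInverse.iterate hs N a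

/-- Points whose first `N + 1` coordinates agree are close, since the remaining coordinates carry
a weight of at most `γ ^ N`. -/
theorem distX_le_of_coord_eq {x y : W.Solenoid} {N : ℕ} (h : x.1 N = y.1 N) :
    W.distX x y ≤ (W.K + 1) * (W.γ ^ N * Metric.diam (univ : Set Y)) := by
  refine W.distX_le fun i _ n => ?_
  have hdiam := Metric.diam_nonneg (s := (univ : Set Y))
  rcases le_total n N with hn | hn
  · rw [← W.iterate_coord_of_le hn x, ← W.iterate_coord_of_le hn y, h, dist_self, mul_zero]
    exact mul_nonneg (pow_nonneg W.γ_pos.le _) hdiam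
  · exact mul_le_mul (pow_le_pow_of_le_one W.γ_pos.le W.γ_lt_one.le hn)
      (Metric.dist_le_diam_of_mem isCompact_univ.isBounded (mem_univ _) (mem_univ _))
      dist_nonneg (pow_nonneg W.γ_pos.le _)

theorem exists_mem_localStable (hd : Dense (W.unstableSet P)) (x : W.Solenoid) {ε : ℝ}
    (hε : 0 < ε) : ∃ y : W.UnstableSpace P, y.1 ∈ W.localStable x ε := by
  have hlim : Tendsto (fun N => (W.K + 1) * (W.γ ^ N * Metric.diam (univ : Set Y))) atTop
      (𝓝 0) := by
    simpa using ((tendsto_pow_atTop_nhds_zero_of_lt_one W.γ_pos.le W.γ_lt_one).mul_const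
      (Metric.diam (univ : Set Y))).const_mul ((W.K : ℝ) + 1)
  obtain ⟨N, hN, hKN⟩ := ((hlim.eventually (gt_mem_nhds hε)).and (eventually_ge_atTop W.K)).exists
  obtain ⟨y, hy⟩ := exists_coord_eq hd x N
  refine ⟨y, fun m hm => ?_, (distX_le_of_coord_eq hy.symm).trans_lt hN⟩
  rw [← W.iterate_coord_of_le (hm.le.trans hKN) x, ← W.iterate_coord_of_le (hm.le.trans hKN) y.1,
    hy]

end WielerPresolenoid

/-! ### Shift equivalences, fixed points and zeta functions -/

section ShiftEquivalence

open Function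

variable {A B : Type*} {f : A → A} {h : B → B}

theorem Function.Semiconj.mapsTo_fixedPoints_iterate {u : A → B} (hu : Semiconj u f h) (n : ℕ) :
    MapsTo u (fixedPoints f^[n]) (fixedPoints h^[n]) := fun a ha => by
  have := hu.iterate_right n a
  rw [mem_fixedPoints, IsFixedPt, ← this, mem_fixedPoints.1 ha]

/-- One half `r` of a shift equivalence `(q, r)` of lag `k` is a bijection between the periodic
points of each period: its inverse is `q ∘ f^(nk - k)`. -/
theorem bijOn_fixedPoints_of_shiftEquiv {q : A → B} {r : B → A} (hq : Semiconj q f h)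
    (hr : Semiconj r h f) {k : ℕ} (hrq : ∀ a, r (q a) = f^[k] a) (hqr : ∀ b, q (r b) = h^[k] b)
    {n : ℕ} (hn : 1 ≤ n) : BijOn r (fixedPoints h^[n]) (fixedPoints f^[n]) := by
  have hle : k ≤ n * k := Nat.le_mul_of_pos_left k hn
  refine ⟨hr.mapsTo_fixedPoints_iterate n, fun b hb b' hb' hbb => ?_, fun a ha => ?_⟩
  · have key : ∀ c ∈ fixedPoints h^[n], h^[n * k - k] (q (r c)) = c := fun c hc => by
      rw [hqr, ← iterate_add_apply, Nat.sub_add_cancel hle, iterate_mul]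
      exact IsFixedPt.iterate hc k
    rw [← key b hb, ← key b' hb', hbb]
  · have hfix : IsFixedPt f^[n] (f^[n * k - k] a) :=
      IsFixedPt.map ha (Commute.iterate_iterate_self f n (n * k - k)).symm.semiconj
    refine ⟨q (f^[n * k - k] a), hq.mapsTo_fixedPoints_iterate n hfix, ?_⟩
    rw [hrq, ← iterate_add_apply, Nat.add_sub_cancel' hle, iterate_mul]
    exact IsFixedPt.iterate ha k

theorem bijOn_periodicPts_of_fixedPoints {u : A → B}
    (hu : ∀ n, 1 ≤ n → BijOn u (fixedPoints f^[n]) (fixedPoints h^[n])) :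
    BijOn u (periodicPts f) (periodicPts h) := by
  refine ⟨?_, ?_, ?_⟩
  · rintro a ⟨n, hn, ha⟩
    exact ⟨n, hn, (hu n hn).mapsTo ha⟩
  · rintro a ⟨n, hn, ha⟩ a' ⟨n', hn', ha'⟩ haa
    exact (hu (n * n') (Nat.mul_pos hn hn')).injOn (ha.mul_const n') (ha'.const_mul n) haa
  · rintro b ⟨n, hn, hb⟩
    obtain ⟨a, ha, rfl⟩ := (hu n hn).surjOn hb
    exact ⟨a, ⟨n, hn, ha⟩, rfl⟩

theorem zetaFunction_eq_of_bijOn {u : A → B}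
    (hu : ∀ n, 1 ≤ n → BijOn u (fixedPoints f^[n]) (fixedPoints h^[n])) :
    zetaFunction f = zetaFunction h := by
  have : fixSeries f = fixSeries h := by
    ext n
    rcases Nat.eq_zero_or_pos n with rfl | hn
    · simp [fixSeries]
    · simp [fixSeries, (hu n hn).ncard_eq]
  rw [zetaFunction, zetaFunction, this]

end ShiftEquivalence

namespace WielerPresolenoid

variable {Y : Type*} [MetricSpace Y] [CompactSpace Y] {W : WielerPresolenoid Y}

/-! ### Periodic points of `φ` and of `g` -/

theorem coord_of_mem_fixedPoints {n : ℕ} (hn : 1 ≤ n) {x : W.Solenoid}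
    (hx : x ∈ Function.fixedPoints W.phi^[n]) (m : ℕ) : x.1 m = W.g^[n * m - m] (x.1 0) := by
  have e : W.phi^[n * m] x = x := by
    rw [Function.iterate_mul]; exact Function.IsFixedPt.iterate hx m
  conv_lhs => rw [← e, phi_iterate_coord, ← Nat.sub_add_cancel (Nat.le_mul_of_pos_left m hn),
    Function.iterate_add_apply]
  rw [iterate_coord_zero]

variable (W) in
theorem bijOn_coord_zero_fixedPoints {n : ℕ} (hn : 1 ≤ n) :
    BijOn (fun x : W.Solenoid => x.1 0) (Function.fixedPoints W.phi^[n])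
      (Function.fixedPoints W.g^[n]) := by
  refine ⟨fun x hx => ?_, fun x hx y hy h0 => ?_, fun a ha => ?_⟩
  · change W.g^[n] (x.1 0) = x.1 0
    rw [← phi_iterate_coord, Function.mem_fixedPoints.1 hx]
  · refine Subtype.ext (funext fun m => ?_)
    rw [coord_of_mem_fixedPoints hn hx, coord_of_mem_fixedPoints hn hy]
    exact congrArg _ h0
  · have hfix : ∀ i, W.g^[n] (W.g^[i] a) = W.g^[i] a := fun i => by
      rw [← Function.iterate_add_apply, add_comm, Function.iterate_add_apply,
        Function.mem_fixedPoints.1 ha]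
    refine ⟨⟨fun m => W.g^[n * m - m] a, fun m => ?_⟩, ?_, by simp⟩
    · change W.g (W.g^[n * (m + 1) - (m + 1)] a) = W.g^[n * m - m] a
      rw [← Function.iterate_succ_apply' W.g, ← hfix (n * m - m), ← Function.iterate_add_apply]
      congr 2
      have := Nat.le_mul_of_pos_left m hn
      rw [Nat.mul_succ]
      omega
    · refine Subtype.ext (funext fun m => ?_)
      rw [phi_iterate_coord]
      exact hfix _

variable (W) in
/-- Two points of period `n` that are sufficiently close have `β`-close orbits; the distance
of their backward orbits is periodic and tends to `0`, hence vanishes. So fixed points of `g^n`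
are uniformly separated. -/
theorem finite_fixedPoints_iterate {n : ℕ} (hn : 1 ≤ n) :
    (Function.fixedPoints W.g^[n]).Finite := by
  obtain ⟨η, hη, H⟩ := W.exists_dist_iterate_lt n W.β_pos
  have sep : ∀ a ∈ Function.fixedPoints W.g^[n], ∀ b ∈ Function.fixedPoints W.g^[n],
      dist a b < η → a = b := by
    intro a ha b hb hab
    obtain ⟨x, hx, rfl⟩ := (W.bijOn_coord_zero_fixedPoints hn).surjOn ha
    obtain ⟨y, hy, rfl⟩ := (W.bijOn_coord_zero_fixedPoints hn).surjOn hb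
    have hmod : ∀ c ∈ Function.fixedPoints W.g^[n], ∀ i, W.g^[i] c = W.g^[i % n] c :=
      fun c hc i => (Function.IsPeriodicPt.iterate_mod_apply hc i).symm
    have hclose : ∀ m, dist (x.1 m) (y.1 m) ≤ W.β := fun m => by
      rw [coord_of_mem_fixedPoints hn hx, coord_of_mem_fixedPoints hn hy, hmod _ ha, hmod _ hb]
      exact (H _ _ hab _ (Nat.mod_lt _ hn).le).le
    have hconst : ∀ m, dist (x.1 (n * m)) (y.1 (n * m)) = dist (x.1 0) (y.1 0) := fun m => by
      have e : (n * (n * m) - n * m) % n = 0 :=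
        Nat.mod_eq_zero_of_dvd (Nat.dvd_sub (Dvd.intro _ rfl) (Dvd.intro _ rfl))
      rw [coord_of_mem_fixedPoints hn hx, coord_of_mem_fixedPoints hn hy, hmod _ ha, hmod _ hb, e]
      rfl
    have hlim := (tendsto_dist_coord hclose).comp (tendsto_id.const_mul_atTop' hn)
    exact dist_eq_zero.1 (tendsto_nhds_unique (tendsto_const_nhds.congr fun m => (hconst m).symm)
      hlim)
  obtain ⟨t, -, ht, hcover⟩ := (isCompact_univ (X := Y)).finite_cover_balls (half_pos hη)
  refine (ht.biUnion (t := fun c => Metric.ball c (η / 2) ∩ Function.fixedPoints W.g^[n])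
    fun c _ => Set.Subsingleton.finite ?_).subset fun a ha => ?_
  · rintro a ⟨hac, ha⟩ b ⟨hbc, hb⟩
    rw [Metric.mem_ball] at hac hbc
    exact sep a ha b hb (by linarith [dist_triangle_right a b c])
  · obtain ⟨c, hc, hac⟩ := mem_iUnion₂.1 (hcover (mem_univ a))
    exact mem_biUnion hc ⟨hac, ha⟩

variable {P : Set W.Solenoid}

/-! ### The shift equivalence between `g` and the induced map -/

/-- The map `Y → X^u(P)/∼₀` sending `a` to the class of the points of `X^u(P)` with `K`-th
coordinate `a`. Such a point is chosen; the class does not depend on the choice by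
`coordClass_coord`. -/
noncomputable def coordClass (hd : Dense (W.unstableSet P)) (εY : ℝ) (a : Y) : W.TildeQuot P εY :=
  Quot.mk _ (exists_coord_eq hd (surjective_coord W.K a).choose W.K).choose

theorem IsLiftRadius.coordClass_eq {ρ : ℝ} (hρ : W.IsLiftRadius ρ) {εY : ℝ} (hεY : 0 < εY)
    (hεβ : εY ≤ W.β / 2) (hd : Dense (W.unstableSet P)) {a : Y} {y : W.UnstableSpace P}
    (h0 : W.pi0 y = W.g^[W.K] a) (hK : dist a (y.1.1 W.K) < ρ) :
    coordClass hd εY a = Quot.mk _ y := by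
  have hz : (exists_coord_eq hd (surjective_coord W.K a).choose W.K).choose.1.1 W.K = a :=
    (exists_coord_eq hd (surjective_coord W.K a).choose W.K).choose_spec.trans
      (surjective_coord W.K a).choose_spec
  refine Quot.sound (hρ.tildeZero hεY hεβ ?_ (by rwa [hz]))
  have hz0 := W.iterate_coord_zero W.K
    (exists_coord_eq hd (surjective_coord W.K a).choose W.K).choose.1
  rw [hz] at hz0
  exact hz0.symm.trans h0.symm

theorem coordClass_coord {εY : ℝ} (hεY : 0 < εY) (hεβ : εY ≤ W.β / 2)
    (hd : Dense (W.unstableSet P)) (y : W.UnstableSpace P) :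
    coordClass hd εY (y.1.1 W.K) = Quot.mk _ y := by
  obtain ⟨ρ, hρ0, hρ⟩ := W.exists_isLiftRadius
  exact hρ.coordClass_eq hεY hεβ hd (W.iterate_coord_zero W.K y.1).symm
    (by rwa [dist_self])

theorem exists_unstable_coord_eq (hd : Dense (W.unstableSet P)) (N : ℕ) (a : Y) :
    ∃ y : W.UnstableSpace P, y.1.1 N = a := by
  obtain ⟨x, rfl⟩ := surjective_coord (W := W) N a
  exact exists_coord_eq hd x N

theorem r_coordClass (hd : Dense (W.unstableSet P)) {εY : ℝ} (hεY : 0 < εY)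
    (hεβ : εY ≤ W.β / 2) (a : Y) : W.r P εY (coordClass hd εY a) = W.g^[W.K] a := by
  obtain ⟨y, rfl⟩ := exists_unstable_coord_eq hd W.K a
  rw [coordClass_coord hεY hεβ]
  exact (W.iterate_coord_zero W.K y.1).symm

/-- A neighbourhood of `a` lifts to a local unstable set of a point `y` with `y_K = a`. The lift
of `b` need not have `b` as its `K`-th coordinate, but it lies in the class of `b`. -/
theorem continuous_coordClass (hd : Dense (W.unstableSet P)) {εY : ℝ} (hεY : 0 < εY)
    (hεβ : εY ≤ W.β / 2) : Continuous (coordClass (W := W) hd εY) := by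
  obtain ⟨ρ, hρ0, hρ⟩ := W.exists_isLiftRadius
  refine continuous_def.2 fun O hO => Metric.isOpen_iff.2 fun a ha => ?_
  obtain ⟨y, rfl⟩ := exists_unstable_coord_eq hd W.K a
  rw [mem_preimage, coordClass_coord hεY hεβ] at ha
  obtain ⟨δ, hδ, hsub⟩ := isOpen_coinduced.1 hO y ha
  obtain ⟨η, hη, H⟩ := W.exists_mem_localUnstable hδ
  obtain ⟨θ, hθ, Hθ⟩ := W.exists_lift (lt_min (lt_min hη W.β_pos) (half_pos hρ0))
  refine ⟨min θ (ρ / 2), lt_min hθ (half_pos hρ0), fun b hb => ?_⟩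
  rw [Metric.mem_ball] at hb
  obtain ⟨w, hw0, hw⟩ := Hθ y.1 b (hb.trans_le (min_le_left _ _))
  have hwβ : ∀ n, dist (y.1.1 n) (w.1 n) ≤ W.β := fun n =>
    ((hw n).trans_le ((min_le_left _ _).trans (min_le_right _ _))).le
  let w' : W.UnstableSpace P := ⟨w, mem_unstableSet_of_dist_tendsto y.2 (tendsto_dist_coord hwβ)⟩
  have hwO : Quot.mk _ w' ∈ O := hsub (H _ _ hwβ
    ((hw 0).trans_le ((min_le_left _ _).trans (min_le_left _ _))))
  rw [mem_preimage, hρ.coordClass_eq hεY hεβ hd (y := w') hw0]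
  · exact hwO
  · have e1 := (hw W.K).trans_le (min_le_right _ _)
    have e2 := hb.trans_le (min_le_right _ _)
    linarith [dist_triangle b (y.1.1 W.K) (w.1 W.K)]

theorem isProjection_coordClass {ρ : ℝ} (hρ : W.IsLiftRadius ρ) {εX εY : ℝ} (hεX : 0 < εX)
    (hεXρ : εX ≤ W.γ ^ W.K * ρ) (hεY : 0 < εY) (hεβ : εY ≤ W.β / 2)
    (hd : Dense (W.unstableSet P)) :
    W.IsProjection εX fun x => coordClass hd εY (x.1 W.K) := by
  refine fun x => ⟨exists_mem_localStable hd x (half_pos hεX), fun y hy => ?_⟩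
  refine hρ.coordClass_eq hεY hεβ hd ?_ ?_
  · rw [iterate_coord_zero]
    exact hy.1 0 W.K_pos
  · refine lt_of_mul_lt_mul_left ?_ (pow_nonneg W.γ_pos.le W.K)
    calc _ ≤ W.distX x y.1 := W.le_distX x y.1 W.K
      _ < εX / 2 := hy.2
      _ ≤ W.γ ^ W.K * ρ := by linarith

/-- The map `[x] ↦ [φ x]`. -/
def inducedMap (hP : MapsTo W.phi P P) {εY : ℝ} (hεY : 0 < εY) (hεβ : εY ≤ W.β / 2) :
    W.TildeQuot P εY → W.TildeQuot P εY :=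
  Quot.map (W.phiU hP) fun _ _ h => h.phiU hεY hεβ hP

section

variable (hP : MapsTo W.phi P P) {εY : ℝ} (hεY : 0 < εY) (hεβ : εY ≤ W.β / 2)

theorem semiconj_coordClass (hd : Dense (W.unstableSet P)) :
    Function.Semiconj (coordClass (W := W) hd εY) W.g (inducedMap hP hεY hεβ) := by
  intro a
  obtain ⟨y, rfl⟩ := exists_unstable_coord_eq hd W.K a
  rw [coordClass_coord hεY hεβ]
  exact coordClass_coord hεY hεβ hd (W.phiU hP y)

theorem semiconj_r : Function.Semiconj (W.r P εY) (inducedMap hP hεY hεβ) W.g := by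
  rintro ⟨y⟩
  rfl

theorem inducedMap_iterate (i : ℕ) (y : W.UnstableSpace P) :
    (inducedMap hP hεY hεβ)^[i] (Quot.mk _ y) = Quot.mk _ ((W.phiU hP)^[i] y) := by
  induction i generalizing y with
  | zero => rfl
  | succ i ih => exact ih (W.phiU hP y)

theorem phiU_iterate_val (i : ℕ) (y : W.UnstableSpace P) :
    ((W.phiU hP)^[i] y).1 = W.phi^[i] y.1 := by
  induction i generalizing y with
  | zero => rfl
  | succ i ih => exact ih (W.phiU hP y)

/-- The class of `y` goes to that of `φ^K y`, since `φ^K y` has `K`-th coordinate `y₀`. -/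
theorem coordClass_r (hd : Dense (W.unstableSet P)) (c : W.TildeQuot P εY) :
    coordClass hd εY (W.r P εY c) = (inducedMap hP hεY hεβ)^[W.K] c := by
  obtain ⟨y⟩ := c
  change coordClass hd εY (y.1.1 0) = (inducedMap hP hεY hεβ)^[W.K] (Quot.mk _ y)
  rw [inducedMap_iterate, ← coordClass_coord hεY hεβ hd, phiU_iterate_val, phi_iterate_coord,
    iterate_coord_zero]

theorem bijOn_r_fixedPoints (hd : Dense (W.unstableSet P)) {n : ℕ} (hn : 1 ≤ n) :
    BijOn (W.r P εY) (Function.fixedPoints (inducedMap hP hεY hεβ)^[n])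
      (Function.fixedPoints W.g^[n]) :=
  bijOn_fixedPoints_of_shiftEquiv (semiconj_coordClass hP hεY hεβ hd) (semiconj_r hP hεY hεβ)
    (r_coordClass hd hεY hεβ) (coordClass_r hP hεY hεβ hd) hn

/-- Composing the projection with `r`, which is bijective on these fixed points, gives `x ↦ x₀`. -/
theorem bijOn_coordClass_fixedPoints (hd : Dense (W.unstableSet P)) {n : ℕ} (hn : 1 ≤ n) :
    BijOn (fun x : W.Solenoid => coordClass hd εY (x.1 W.K)) (Function.fixedPoints W.phi^[n])
      (Function.fixedPoints (inducedMap hP hεY hεβ)^[n]) := by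
  have hr := bijOn_r_fixedPoints hP hεY hεβ hd hn
  have h0 := W.bijOn_coord_zero_fixedPoints hn
  have hcomp : ∀ x : W.Solenoid, W.r P εY (coordClass hd εY (x.1 W.K)) = x.1 0 := fun x => by
    rw [r_coordClass hd hεY hεβ, iterate_coord_zero]
  have hmaps : MapsTo (fun x : W.Solenoid => coordClass hd εY (x.1 W.K))
      (Function.fixedPoints W.phi^[n]) (Function.fixedPoints (inducedMap hP hεY hεβ)^[n]) :=
    Function.Semiconj.mapsTo_fixedPoints_iterate
      (fun x => semiconj_coordClass hP hεY hεβ hd (x.1 W.K)) n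
  refine ⟨hmaps, fun x hx y hy hxy => h0.injOn hx hy ?_, fun c hc => ?_⟩
  · rw [← hcomp x, ← hcomp y]
    exact congrArg _ hxy
  · obtain ⟨x, hx, hxc⟩ := h0.surjOn (hr.mapsTo hc)
    exact ⟨x, hx, hr.injOn (hmaps hx) hc ((hcomp x).trans hxc)⟩

end

end WielerPresolenoid

/-! ### Periodic points and zeta functions of `φ`, of the induced map and of `g` -/

theorem mainTheorem11 {Y : Type*} [MetricSpace Y] [CompactSpace Y] [Infinite Y]
    (W : WielerPresolenoid Y) :
    ∃ ε₀ : ℝ, 0 < ε₀ ∧ ε₀ ≤ W.β / 2 ∧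
      ∀ εX εY : ℝ, 0 < εX → εX ≤ ε₀ → 0 < εY → εY ≤ ε₀ →
      ∀ (P : Set W.Solenoid) (hP : MapsTo W.phi P P), P.Finite →
        P ⊆ Function.periodicPts W.phi → Dense (W.unstableSet P) →
        Equivalence (W.TildeZero P εY) ∧
        ∃ (gt : W.TildeQuot P εY → W.TildeQuot P εY) (p : W.Solenoid → W.TildeQuot P εY),
          W.IsInducedMap hP gt ∧ W.IsProjection εX p ∧
          BijOn p (Function.periodicPts W.phi) (Function.periodicPts gt) ∧
          BijOn (W.r P εY) (Function.periodicPts gt) (Function.periodicPts W.g) ∧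
          (∀ n : ℕ, 1 ≤ n →
            (Function.fixedPoints W.phi^[n]).Finite ∧ (Function.fixedPoints gt^[n]).Finite ∧
              (Function.fixedPoints W.g^[n]).Finite) ∧
          zetaFunction W.phi = zetaFunction gt ∧
          zetaFunction gt = zetaFunction W.g ∧
          (Dense (Function.periodicPts W.phi) → Dense (Function.periodicPts gt)) := by
  obtain ⟨ρ, hρ0, hρ⟩ := W.exists_isLiftRadius
  refine ⟨min (W.β / 2) (W.γ ^ W.K * ρ),
    lt_min (half_pos W.β_pos) (mul_pos (pow_pos W.γ_pos _) hρ0), min_le_left _ _, ?_⟩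
  intro εX εY hεX hεX₀ hεY hεY₀ P hP _ _ hd
  have hεβ : εY ≤ W.β / 2 := hεY₀.trans (min_le_left _ _)
  have hr := fun n hn => WielerPresolenoid.bijOn_r_fixedPoints hP hεY hεβ hd (n := n) hn
  have hp := fun n hn => WielerPresolenoid.bijOn_coordClass_fixedPoints hP hεY hεβ hd (n := n) hn
  have hpp := bijOn_periodicPts_of_fixedPoints hp
  refine ⟨WielerPresolenoid.equivalence_tildeZero hεY hεβ,
    WielerPresolenoid.inducedMap hP hεY hεβ,
    fun x => WielerPresolenoid.coordClass hd εY (x.1 W.K), fun _ => rfl,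
    WielerPresolenoid.isProjection_coordClass hρ hεX (hεX₀.trans (min_le_right _ _)) hεY hεβ hd,
    hpp, bijOn_periodicPts_of_fixedPoints hr, fun n hn => ?_, zetaFunction_eq_of_bijOn hp,
    zetaFunction_eq_of_bijOn hr, fun hdense => ?_⟩
  · have hg := W.finite_fixedPoints_iterate hn
    exact ⟨(W.bijOn_coord_zero_fixedPoints hn).finite_iff_finite.2 hg,
      (hr n hn).finite_iff_finite.2 hg, hg⟩
  · have hcont : Continuous fun x : W.Solenoid =>
        WielerPresolenoid.coordClass hd εY (x.1 W.K) :=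
      (WielerPresolenoid.continuous_coordClass hd hεY hεβ).comp
        ((continuous_apply _).comp continuous_subtype_val)
    have hsurj : Function.Surjective fun x : W.Solenoid =>
        WielerPresolenoid.coordClass hd εY (x.1 W.K) := by
      rintro ⟨y⟩
      exact ⟨y.1, WielerPresolenoid.coordClass_coord hεY hεβ hd y⟩
    exact (hsurj.denseRange.dense_image hcont hdense).mono hpp.mapsTo.image_subset
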